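/- Let $0\le m\le n$ and $k\ge 1$ be integers, and let $\mathbb R^n$ carry its standard Euclidean structure. Let $$G_m(\mathbb R^n)=\{u_1\wedge\dots\wedge u_m:\ u_1,\dots,u_m\in\mathbb R^n \text{ orthonormal}\}\subset \textstyle\bigwedge^m\mathbb R^n$$ be the Plücker embedding of the Grassmannian of oriented $m$-dimensional subspaces of $\mathbb R^n$ (for $m=0$ the empty wedge product is $1$), and let $dx$ be the Haar probability measure on $G_m(\mathbb R^n)$, that is, the image of the Haar probability measure of the orthogonal group $O(n)$ under $g\mapsto g e_1\wedge\dots\wedge g e_m$, where $e_1,\dots,e_n$ is the standard basis of $\mathbb R^n$. For a linear functional $\ell:\bigwedge^m\mathbb R^n\to\mathbb R$ put $$\|\ell\|_{2k}=\left(\int_{G_m(\mathbb R^n)}\ell^{2k}(x)\,dx\right)^{1/2k}.$$ Then $|\ell|$ attains a maximum on $G_m(\mathbb R^n)$, and $$\|\ell\|_{2k}\ \le\ \max_{x\in G_m(\mathbb R^n)}|\ell(x)|\ \le\ d_k^{1/2k}\,\|\ell\|_{2k},\qquad\text{where}\quad d_k=\prod_{i=1}^m\prod_{j=1}^k\frac{n+j-i}{m+k-i-j+1}.$$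 Moreover, $d_k$ is the dimension of the $GL_n(\mathbb R)$-module indexed by the rectangular Young diagram with $m$ rows of length $k$, that is, of the image of the Young symmetrizer of this diagram (symmetrization over the rows followed by antisymmetrization over the columns) acting on $(\mathbb R^n)^{\otimes mk}$. -/

import Mathlib

open scoped TensorProduct

noncomputable section

namespace Comass

/-- `ℝⁿ` with its standard Euclidean structure. -/
abbrev Space (n : ℕ) : Type := EuclideanSpace ℝ (Fin n)

/-- The exterior power `⋀ᵐ ℝⁿ`. -/
abbrev Ext (n m : ℕ) : Type := ⋀[ℝ]^m (Space n)

/-- The simple `m`-vector `u₁ ∧ … ∧ u_m`. -/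
abbrev wedge {n m : ℕ} (u : Fin m → Space n) : Ext n m := exteriorPower.ιMulti ℝ m u

/-- The Plücker embedding of the Grassmannian of oriented `m`-dimensional subspaces of `ℝⁿ`: the
oriented subspace with positively oriented orthonormal basis `u₁, …, u_m` is the `m`-vector
`u₁ ∧ … ∧ u_m`, which does not depend on the choice of that basis. -/
def grassmannian (n m : ℕ) : Set (Ext n m) :=
  {x | ∃ u : Fin m → Space n, Orthonormal ℝ u ∧ x = wedge u}

/-- The Borel σ-algebra of the finite-dimensional real vector space `⋀ᵐ ℝⁿ`, that is, the smallest
one for which all linear functionals are measurable. Subsets of `⋀ᵐ ℝⁿ`, in particular the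
Grassmannian, carry the induced σ-algebra. -/
instance instMeasurableSpaceExt (n m : ℕ) : MeasurableSpace (Ext n m) :=
  ⨆ l : Module.Dual ℝ (Ext n m), (borel ℝ).comap l

/-- The orthogonal group `O(n)`. -/
abbrev O (n : ℕ) : Type := Matrix.orthogonalGroup (Fin n) ℝ

instance instMeasurableSpaceO (n : ℕ) : MeasurableSpace (O n) := borel (O n)

instance instBorelSpaceO (n : ℕ) : BorelSpace (O n) := ⟨rfl⟩

instance instCompactSpaceO (n : ℕ) : CompactSpace (O n) := by
  refine isCompact_iff_compactSpace.1 (?_ : IsCompact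
    ((Matrix.orthogonalGroup (Fin n) ℝ : Submonoid (Matrix (Fin n) (Fin n) ℝ)) :
      Set (Matrix (Fin n) (Fin n) ℝ)))
  have hK : IsCompact (Set.univ.pi fun _ : Fin n => Set.univ.pi fun _ : Fin n =>
      Metric.closedBall (0 : ℝ) 1) :=
    isCompact_univ_pi fun _ => isCompact_univ_pi fun _ => isCompact_closedBall 0 1
  refine hK.of_isClosed_subset ?_ ?_
  · have h : ((Matrix.orthogonalGroup (Fin n) ℝ : Submonoid (Matrix (Fin n) (Fin n) ℝ)) :
        Set (Matrix (Fin n) (Fin n) ℝ)) = {A | A * A.transpose = 1} := by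
      ext A
      exact Matrix.mem_orthogonalGroup_iff (Fin n) ℝ
    rw [h]
    exact isClosed_eq (by fun_prop) continuous_const
  · intro A hA i _ j _
    rw [mem_closedBall_zero_iff]
    exact entry_norm_bound_of_unitary hA i j

/-- The Haar probability measure on the compact group `O(n)`. -/
def haarO (n : ℕ) : MeasureTheory.Measure (O n) := MeasureTheory.Measure.haarMeasure ⊤

instance instIsProbabilityMeasureHaarO (n : ℕ) :
    MeasureTheory.IsProbabilityMeasure (haarO n) := by
  constructor
  have h := MeasureTheory.Measure.haarMeasure_self (K₀ := (⊤ : TopologicalSpace.PositiveCompacts (O n)))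
  simpa [haarO] using h

/-- The linear action of a matrix on `⋀ᵐ ℝⁿ`: the `m`-th exterior power of its action on `ℝⁿ`. -/
def extAct {n : ℕ} (m : ℕ) (A : Matrix (Fin n) (Fin n) ℝ) : Ext n m →ₗ[ℝ] Ext n m :=
  exteriorPower.map m (Matrix.toEuclideanLin A)

theorem extAct_mem {n m : ℕ} (g : O n) {x : Ext n m} (hx : x ∈ grassmannian n m) :
    extAct m g.1 x ∈ grassmannian n m := by
  obtain ⟨u, hu, rfl⟩ := hx
  refine ⟨fun i => Matrix.toEuclideanLin g.1 (u i), ?_, ?_⟩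
  · have hA : g.1.transpose * g.1 = 1 := (Matrix.mem_orthogonalGroup_iff' (Fin n) ℝ).1 g.2
    have key : ∀ x y : Space n,
        inner ℝ (Matrix.toEuclideanLin g.1 x) (Matrix.toEuclideanLin g.1 y) = inner ℝ x y := by
      intro x y
      rw [← LinearMap.adjoint_inner_right, ← Matrix.toEuclideanLin_conjTranspose_eq_adjoint,
        Matrix.conjTranspose_eq_transpose_of_trivial, ← LinearMap.comp_apply,
        ← Matrix.toLpLin_mul_same, hA, Matrix.toLpLin_one]
      rfl
    rw [orthonormal_iff_ite] at hu ⊢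
    intro i j
    rw [key, hu]
  · simp only [extAct, wedge, exteriorPower.map_apply_ιMulti]
    rfl

/-- The `m`-vector `e₁ ∧ … ∧ e_m` of the first `m` standard basis vectors, for `m ≤ n`. -/
def baseVector {n m : ℕ} (h : m ≤ n) : Ext n m :=
  wedge fun i => EuclideanSpace.single (Fin.castLE h i) (1 : ℝ)

theorem baseVector_mem {n m : ℕ} (h : m ≤ n) : baseVector h ∈ grassmannian n m :=
  ⟨_, (EuclideanSpace.orthonormal_single (𝕜 := ℝ) (ι := Fin n)).comp _
    (Fin.castLE_injective h), rfl⟩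

/-- The orbit map `g ↦ g (e₁ ∧ … ∧ e_m)` from `O(n)` to the Grassmannian. -/
def orbitMap {n m : ℕ} (h : m ≤ n) (g : O n) : grassmannian n m :=
  ⟨extAct m g.1 (baseVector h), extAct_mem g (baseVector_mem h)⟩

/-- The Haar probability measure on the Grassmannian: the image of the Haar probability measure
of `O(n)` under the orbit map. -/
def haarGrassmannian {n m : ℕ} (h : m ≤ n) : MeasureTheory.Measure (grassmannian n m) :=
  (haarO n).map (orbitMap h)

theorem measurable_iff_dual {α : Type*} [MeasurableSpace α] {n m : ℕ} {f : α → Ext n m} :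
    Measurable f ↔ ∀ l : Module.Dual ℝ (Ext n m), Measurable fun a => l (f a) := by
  simp only [measurable_iff_comap_le, instMeasurableSpaceExt, MeasurableSpace.comap_iSup,
    iSup_le_iff, MeasurableSpace.comap_comp]
  rw [← BorelSpace.measurable_eq (α := ℝ)]
  rfl

theorem continuous_multilinear {n m : ℕ}
    (f : MultilinearMap ℝ (fun _ : Fin m => Space n) ℝ) : Continuous f := by
  have h : ∀ u : Fin m → Space n, f u = ∑ r : Fin m → Fin n,
      (∏ i, u i (r i)) • f fun i => EuclideanSpace.basisFun (Fin n) ℝ (r i) := by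
    intro u
    have hu : u = fun i => ∑ j, u i j • EuclideanSpace.basisFun (Fin n) ℝ j :=
      funext fun i => ((EuclideanSpace.basisFun (Fin n) ℝ).sum_repr (u i)).symm
    conv_lhs => rw [hu]
    rw [MultilinearMap.map_sum]
    simp only [MultilinearMap.map_smul_univ]
  rw [show (f : (Fin m → Space n) → ℝ) = _ from funext h]
  fun_prop

theorem measurable_orbitMap {n m : ℕ} (h : m ≤ n) : Measurable (orbitMap h) := by
  refine Measurable.subtype_mk (measurable_iff_dual.2 fun l => ?_)
  refine Continuous.measurable ?_
  have hc : Continuous (l.compAlternatingMap (exteriorPower.ιMulti ℝ m (M := Space n))) :=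
    continuous_multilinear
      (l.compAlternatingMap (exteriorPower.ιMulti ℝ m (M := Space n))).toMultilinearMap
  have he : (fun g : O n => l (extAct m g.1 (baseVector h))) = fun g : O n =>
      l.compAlternatingMap (exteriorPower.ιMulti ℝ m) fun i =>
        Matrix.toEuclideanLin g.1 (EuclideanSpace.single (Fin.castLE h i) (1 : ℝ)) := by
    funext g
    simp only [extAct, baseVector, wedge, exteriorPower.map_apply_ιMulti]
    rfl
  rw [he]
  refine hc.comp (continuous_pi fun i => ?_)
  have h2 : Continuous fun A : Matrix (Fin n) (Fin n) ℝ =>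
      Matrix.toEuclideanLin A (EuclideanSpace.single (Fin.castLE h i) (1 : ℝ)) :=
    LinearMap.continuous_of_finiteDimensional
      (((LinearMap.applyₗ (EuclideanSpace.single (Fin.castLE h i) (1 : ℝ)) :
        (Space n →ₗ[ℝ] Space n) →ₗ[ℝ] Space n)).comp
          (Matrix.toEuclideanLin (𝕜 := ℝ) (m := Fin n) (n := Fin n)).toLinearMap)
  exact h2.comp continuous_subtype_val

instance instIsProbabilityMeasureHaarGrassmannian {n m : ℕ} (h : m ≤ n) :
    MeasureTheory.IsProbabilityMeasure (haarGrassmannian h) :=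
  MeasureTheory.Measure.isProbabilityMeasure_map (measurable_orbitMap h).aemeasurable

/-- The Haar probability measure on the Grassmannian is invariant under the orthogonal group. -/
theorem haarGrassmannian_invariant {n m : ℕ} (h : m ≤ n) (g : O n) :
    (haarGrassmannian h).map (fun x => (⟨extAct m g.1 x.1, extAct_mem g x.2⟩ : grassmannian n m))
      = haarGrassmannian h := by
  have hm : Measurable
      (fun x : grassmannian n m => (⟨extAct m g.1 x.1, extAct_mem g x.2⟩ : grassmannian n m)) :=
    Measurable.subtype_mk (measurable_iff_dual.2 fun l =>
      (measurable_iff_dual.1 measurable_subtype_coe) (l.comp (extAct m g.1)))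
  have hcomp : (fun x : grassmannian n m =>
        (⟨extAct m g.1 x.1, extAct_mem g x.2⟩ : grassmannian n m)) ∘ orbitMap h
      = orbitMap h ∘ fun a => g * a := by
    funext a
    apply Subtype.ext
    change extAct m g.1 (extAct m a.1 (baseVector h)) = extAct m (g.1 * a.1) (baseVector h)
    simp only [extAct]
    rw [← LinearMap.comp_apply, ← exteriorPower.map_comp]
    congr 2
    exact (Matrix.toLpLin_mul_same 2 g.1 a.1).symm
  have hg : (haarO n).map (fun a => g * a) = haarO n :=
    MeasureTheory.map_mul_left_eq_self (μ := MeasureTheory.Measure.haarMeasure ⊤) g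
  rw [haarGrassmannian, MeasureTheory.Measure.map_map hm (measurable_orbitMap h), hcomp,
    ← MeasureTheory.Measure.map_map (measurable_orbitMap h) (measurable_const_mul g), hg]

/-- The norm `‖l‖_{2k}` of a linear functional on `⋀ᵐ ℝⁿ` in `L^{2k}` of the Grassmannian. -/
def evenNorm {n m : ℕ} (h : m ≤ n) (k : ℕ) (l : Ext n m →ₗ[ℝ] ℝ) : ℝ :=
  (∫ x : grassmannian n m, l x.1 ^ (2 * k) ∂haarGrassmannian h) ^ (1 / (2 * (k : ℝ)))

/-- The number `d_k`, as a product over the boxes `(i, j)` of the `m × k` rectangle. -/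
def hookProduct (n m k : ℕ) : ℝ :=
  ∏ i ∈ Finset.Icc 1 m, ∏ j ∈ Finset.Icc 1 k,
    ((n : ℝ) + j - i) / ((m : ℝ) + k - i - j + 1)

/-- The tensor power of `ℝⁿ` with one factor for each box of the Young diagram with `m` rows of
length `k`; the box in row `i` and column `j` is `(i, j)`. -/
abbrev BoxTensor (n m k : ℕ) : Type := ⨂[ℝ] _ : Fin m × Fin k, Space n

/-- The permutation of the tensor factors by `σ`. -/
def permute {n m k : ℕ} (σ : Equiv.Perm (Fin m × Fin k)) : BoxTensor n m k →ₗ[ℝ] BoxTensor n m k :=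
  (PiTensorProduct.reindex ℝ (fun _ : Fin m × Fin k => Space n) σ).toLinearMap

/-- Symmetrization over the permutations that preserve every row. -/
def rowSymmetrizer (n m k : ℕ) : BoxTensor n m k →ₗ[ℝ] BoxTensor n m k :=
  ∑ σ : Equiv.Perm (Fin m × Fin k) with ∀ b, (σ b).1 = b.1, permute σ

/-- Antisymmetrization over the permutations that preserve every column. -/
def columnAntisymmetrizer (n m k : ℕ) : BoxTensor n m k →ₗ[ℝ] BoxTensor n m k :=
  ∑ σ : Equiv.Perm (Fin m × Fin k) with ∀ b, (σ b).2 = b.2,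
    ((Equiv.Perm.sign σ : ℤ) : ℝ) • permute σ

/-- The `GL_n`-module of the rectangular `m × k` Young diagram: the image of the Young symmetrizer
on the tensor power of `ℝⁿ`. -/
def schurModule (n m k : ℕ) : Submodule ℝ (BoxTensor n m k) :=
  LinearMap.range (columnAntisymmetrizer n m k ∘ₗ rowSymmetrizer n m k)

/-- The Schur module is stable under the diagonal action of `GL_n`. -/
theorem map_schurModule_le (n m k : ℕ) (g : GL (Fin n) ℝ) :
    (schurModule n m k).map
      (PiTensorProduct.map fun _ : Fin m × Fin k => Matrix.toEuclideanLin g.1) ≤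
        schurModule n m k := by
  have hp : ∀ σ : Equiv.Perm (Fin m × Fin k), ∀ x : BoxTensor n m k,
      (PiTensorProduct.map fun _ : Fin m × Fin k => Matrix.toEuclideanLin g.1) (permute σ x) =
        permute σ
          ((PiTensorProduct.map fun _ : Fin m × Fin k => Matrix.toEuclideanLin g.1) x) :=
    fun σ x => PiTensorProduct.map_reindex
      (fun _ : Fin m × Fin k => Matrix.toEuclideanLin g.1) σ x
  rintro _ ⟨_, ⟨x, rfl⟩, rfl⟩
  refine ⟨(PiTensorProduct.map fun _ : Fin m × Fin k => Matrix.toEuclideanLin g.1) x, ?_⟩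
  simp only [LinearMap.comp_apply, columnAntisymmetrizer, rowSymmetrizer, LinearMap.sum_apply,
    LinearMap.smul_apply, map_sum, map_smul, hp]

end Comass

end

open scoped TensorProduct

noncomputable section

namespace Comass

open MvPolynomial Matrix MeasureTheory

/-! ### Derivations of products and determinants -/

section DetDerivation

variable {R A ι : Type*} [CommRing R] [CommRing A] [Algebra R A]

/-! On the first `m` columns of an orthogonal matrix, `ℓ` is a combination of maximal minors. Hence
`ℓ ^ k` comes from a polynomial in `semiInv n m k`, the polynomials on `n × m` matrices of weight
`det ^ k` under column operations. This space is stable under left multiplication by matrices. In a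
left-invariant space of functions on a compact group, of dimension `d`, the diagonal of the
reproducing kernel is constant and has integral `d`, so `f g ^ 2 ≤ d * ∫ f ^ 2`
(`sq_apply_le_finrank_mul_integral`). Taking `f = ℓ ^ k` and extracting a root gives the upper
bound. The lower one holds because the measure is a probability measure.

It remains to see that `semiInv n m k` has dimension `d_k`. Multiplication by a maximal minor raises
the weight by one, and the differential operator `minor(∂)` lowers it by one. Summed over all row
selections, their products in either order are scalars (`sum_minor_mul_diffOp`,
`sum_diffOp_minor_minor_mul`), by Capelli-type identities proved one column at a time. Equality of
the traces of the two products yields a recursion for the dimension, which is solved by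
`hookProduct`. The first identity also shows that products of `k` maximal minors span `semiInv n m
k`.

Finally, the coordinates of the generators of the Schur module are exactly these products of minors,
as functions of the row vectors. So the dual of the Schur module is isomorphic to their span, and
`finrank_schurModule` follows. -/

theorem derivation_prod [DecidableEq ι] (D : Derivation R A A) (s : Finset ι) (f : ι → A) :
    D (∏ i ∈ s, f i) = ∑ i ∈ s, (∏ j ∈ s.erase i, f j) * D (f i) := by
  induction s using Finset.induction_on with
  | empty => simp
  | insert a s ha ih =>
    rw [Finset.prod_insert ha, D.leibniz, ih, Finset.sum_insert ha, Finset.erase_insert ha,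
      smul_eq_mul, smul_eq_mul, add_comm, Finset.mul_sum]
    congr 1
    refine Finset.sum_congr rfl fun i hi => ?_
    have hne : a ≠ i := fun h => ha (h ▸ hi)
    rw [Finset.erase_insert_of_ne hne, Finset.prod_insert (fun h => ha (Finset.mem_of_mem_erase h)),
      mul_assoc]

theorem derivation_det [Fintype ι] [DecidableEq ι] (D : Derivation R A A) (M : Matrix ι ι A) :
    D M.det = ∑ b, (M.updateCol b fun i => D (M i b)).det := by
  simp only [det_apply, map_sum]
  rw [Finset.sum_comm]
  refine Finset.sum_congr rfl fun σ _ => ?_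
  rw [← Finset.smul_sum, Units.smul_def, Units.smul_def, map_zsmul, derivation_prod]
  congr 1
  refine Finset.sum_congr rfl fun b _ => ?_
  rw [← Finset.mul_prod_erase Finset.univ _ (Finset.mem_univ b), updateCol_self, mul_comm]
  congr 1
  exact Finset.prod_congr rfl fun j hj => (updateCol_ne (Finset.ne_of_mem_erase hj)).symm

end DetDerivation

/-! ### Polarization and differential operators with constant coefficients -/

/-- The polynomial ring in the entries of an `n × m` matrix. -/
abbrev MatPoly (n m : ℕ) : Type := MvPolynomial (Fin n × Fin m) ℝ

variable {n m s k : ℕ}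

/-- The polarization operator `∑ i, x i a ∂/∂(x i b)`. -/
def polar (n : ℕ) {m : ℕ} (a b : Fin m) : Derivation ℝ (MatPoly n m) (MatPoly n m) :=
  ∑ i : Fin n, (X (i, a) : MatPoly n m) • pderiv (i, b)

theorem polar_apply (a b : Fin m) (p : MatPoly n m) :
    polar n a b p = ∑ i, X (i, a) * pderiv (i, b) p := by
  rw [polar, ← Derivation.coeFnAddMonoidHom_apply, map_sum, Finset.sum_apply]
  simp

theorem polar_X (a b c : Fin m) (i : Fin n) :
    polar n a b (X (i, c)) = if c = b then X (i, a) else 0 := by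
  rw [polar_apply]
  simp only [pderiv_X, Pi.single_apply, Prod.mk.injEq]
  split_ifs with h
  · subst h
    simp
  · simp [h]

/-- The derivations `∂/∂x` commute. -/
theorem pderiv_commute {σ : Type*} (s t : σ) (p : MvPolynomial σ ℝ) :
    pderiv s (pderiv t p) = pderiv t (pderiv s p) := by
  have h : ⁅pderiv (R := ℝ) s, pderiv (R := ℝ) t⁆ = 0 := by
    classical
    ext u
    simp [Derivation.commutator_apply, pderiv_X, Pi.single_apply, apply_ite]
  have := congrArg (fun D => D p) h
  simpa [Derivation.commutator_apply, sub_eq_zero] using this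

section ConstantCoefficients

variable {σ : Type*}

/-- The algebra generated by the partial derivatives. -/
abbrev diffAlg (σ : Type*) : Subalgebra ℝ (Module.End ℝ (MvPolynomial σ ℝ)) :=
  Algebra.adjoin ℝ (Set.range fun s => ((pderiv s : Derivation ℝ (MvPolynomial σ ℝ) (MvPolynomial σ ℝ)) :
    MvPolynomial σ ℝ →ₗ[ℝ] MvPolynomial σ ℝ))

/-- `aeval` needs a commutative target, so `p(∂)` is first formed in this subalgebra and then
regarded as an endomorphism. -/
instance diffAlg.isMulCommutative : IsMulCommutative (diffAlg σ) :=
  Algebra.isMulCommutative_adjoin ℝ <| by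
    rintro _ ⟨s, rfl⟩ _ ⟨t, rfl⟩
    exact LinearMap.ext fun p => pderiv_commute s t p

open scoped IsMulCommutative in
/-- The differential operator with constant coefficients `p(∂)`. -/
def diffOp : MvPolynomial σ ℝ →ₐ[ℝ] Module.End ℝ (MvPolynomial σ ℝ) :=
  (diffAlg σ).val.comp
    (aeval fun s => (⟨(pderiv s : Derivation ℝ (MvPolynomial σ ℝ) (MvPolynomial σ ℝ)),
      Algebra.subset_adjoin ⟨s, rfl⟩⟩ : diffAlg σ))

theorem diffOp_X (s : σ) (f : MvPolynomial σ ℝ) : diffOp (X s) f = pderiv s f := by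
  simp [diffOp]

theorem diffOp_mul (p q f : MvPolynomial σ ℝ) : diffOp (p * q) f = diffOp p (diffOp q f) := by
  rw [map_mul]; rfl

/-- The commutator of `p(∂)` with multiplication by a variable obeys the Leibniz rule in `p`, so it
is determined by the relations between the variables and the `∂`. -/
theorem diffOp_X_mul (p f : MvPolynomial σ ℝ) (s : σ) :
    diffOp p (X s * f) = X s * diffOp p f + diffOp (pderiv s p) f := by
  induction p using MvPolynomial.induction_on generalizing f with
  | C a =>
    rw [show (C a : MvPolynomial σ ℝ) = algebraMap ℝ _ a from rfl, AlgHom.commutes]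
    simp [Module.algebraMap_end_apply]
  | add p q hp hq =>
    simp only [map_add, LinearMap.add_apply, hp, hq]
    ring
  | mul_X p t hp =>
    classical
    rw [diffOp_mul, diffOp_X, diffOp_mul, diffOp_X, Derivation.leibniz, map_add, smul_eq_mul,
      smul_eq_mul, hp, Derivation.leibniz, map_add, LinearMap.add_apply, smul_eq_mul, smul_eq_mul,
      mul_comm (X t) (pderiv s p), diffOp_mul _ (X t), diffOp_X, pderiv_X, pderiv_X]
    by_cases h : s = t
    · subst h; simp; ring
    · simp [h, Ne.symm h]

end ConstantCoefficients

/-- Polarization acts on constant-coefficient operators by the dual action, whence the swapped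
indices and the minus sign. -/
theorem polar_diffOp (a b : Fin m) (p f : MatPoly n m) :
    polar n a b (diffOp p f) = diffOp p (polar n a b f) - diffOp (polar n b a p) f := by
  have h : ∀ i, diffOp p (X (i, a) * pderiv (i, b) f) =
      X (i, a) * pderiv (i, b) (diffOp p f) + diffOp (X (i, b) * pderiv (i, a) p) f := by
    intro i
    rw [diffOp_X_mul, ← diffOp_X (i, b) f, ← diffOp_X (i, b) (diffOp p f), ← diffOp_mul,
      ← diffOp_mul, ← diffOp_mul, mul_comm p, mul_comm (pderiv (i, a) p)]
  rw [polar_apply, polar_apply, polar_apply, map_sum, map_sum, LinearMap.sum_apply]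
  simp only [h, Finset.sum_add_distrib]
  ring

/-! ### Minors and cofactors -/

/-- The minor of the generic `n × m` matrix with rows `r` and columns `c`. -/
def minor (c : Fin s → Fin m) (r : Fin s → Fin n) : MatPoly n m :=
  det (of fun a b => X (r a, c b))

/-- The cofactor of the entry in column `j` of an additional first row. -/
def cofactor (c : Fin (s + 1) → Fin m) (r : Fin s → Fin n) (j : Fin (s + 1)) : MatPoly n m :=
  det (of (Fin.cons (Pi.single j 1) fun a b => X (r a, c b) :
    Fin (s + 1) → Fin (s + 1) → MatPoly n m))

theorem minor_cons (c : Fin (s + 1) → Fin m) (r₀ : Fin n) (r : Fin s → Fin n) :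
    minor c (Fin.cons r₀ r : Fin (s + 1) → Fin n) = ∑ j, X (r₀, c j) * cofactor c r j := by
  rw [minor, det_eq_sum_mul_adjugate_row _ 0]
  refine Finset.sum_congr rfl fun j _ => ?_
  rw [adjugate_apply, cofactor, of_apply, Fin.cons_zero]
  congr 2
  ext a b : 2
  refine Fin.cases ?_ (fun a => ?_) a
  · simp
  · simp

theorem cofactor_zero (c : Fin (s + 1) → Fin m) (r : Fin s → Fin n) :
    cofactor c r 0 = minor (c ∘ Fin.succ) r := by
  rw [cofactor, det_succ_row_zero, Finset.sum_eq_single 0]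
  · simp only [Fin.val_zero, pow_zero, of_apply, Fin.cons_zero, Pi.single_eq_same, one_mul, minor]
    rfl
  · intro b _ hb
    simp [Pi.single_eq_of_ne hb]
  · simp

/-- Polarization overwrites column `0` by column `j`, which for `j ≠ 0` creates a repeated column.
Only the constant first row behaves differently, and it is the source of the correction term. -/
theorem polar_cofactor {c : Fin (s + 1) → Fin m} (hc : Function.Injective c) (r : Fin s → Fin n)
    (j : Fin (s + 1)) :
    polar n (c j) (c 0) (cofactor c r j) =
      (if j = 0 then cofactor c r 0 else 0) - cofactor c r 0 := by
  set N : Matrix (Fin (s + 1)) (Fin (s + 1)) (MatPoly n m) :=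
    of (Fin.cons (Pi.single j 1) fun a b => X (r a, c b) : Fin (s + 1) → Fin (s + 1) → MatPoly n m)
    with hN
  have hN0 : ∀ b, N 0 b = if b = j then 1 else 0 := fun b => by
    simp [hN, Pi.single_apply]
  have hNs : ∀ a b, N (Fin.succ a) b = X (r a, c b) := fun a b => by simp [hN]
  have hd : polar n (c j) (c 0) (cofactor c r j) =
      (N.updateCol 0 fun i => polar n (c j) (c 0) (N i 0)).det := by
    rw [cofactor, derivation_det, Finset.sum_eq_single 0]
    · intro b _ hb
      refine det_eq_zero_of_column_eq_zero b fun i => ?_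
      rw [updateCol_self]
      refine Fin.cases ?_ (fun a => ?_) i
      · change polar n (c j) (c 0) (N 0 b) = 0
        rw [hN0]
        split_ifs <;> simp
      · change polar n (c j) (c 0) (N a.succ b) = 0
        rw [hNs, polar_X, if_neg fun h => hb (hc h)]
    · simp
  -- The derivation kills the constant in the first row, whereas column `j` has a `1` there. The
  -- multiple of the first unit vector removes it.
  have hcol : (fun i => polar n (c j) (c 0) (N i 0)) =
      (fun i => N i j) + (-1 : MatPoly n m) • (Pi.single 0 1 : Fin (s + 1) → MatPoly n m) := by
    funext i
    refine Fin.cases ?_ (fun a => ?_) i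
    · rw [hN0]
      simp only [Pi.add_apply, Pi.smul_apply, hN0]
      split_ifs <;> simp
    · simp [hNs, polar_X]
  rw [hd, hcol, det_updateCol_add, det_updateCol_smul]
  have h1 : (N.updateCol 0 fun i => N i j).det = if j = 0 then cofactor c r 0 else 0 := by
    split_ifs with h
    · subst h
      rw [updateCol_eq_self, cofactor]
    · exact det_updateCol_eq_zero h
  have h2 : (N.updateCol 0 (Pi.single 0 1)).det = cofactor c r 0 := by
    rw [cofactor_zero, minor, det_succ_column_zero, Finset.sum_eq_single 0]
    · simp only [Fin.val_zero, pow_zero, updateCol_self, Pi.single_eq_same, one_mul]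
      congr 1
    · intro b _ hb
      simp [hb]
    · simp
  rw [h1, h2]
  ring

/-! ### Semi-invariants of the column action -/

/-- The polynomials of weight `det ^ k` under the action of `GL m` on the columns. -/
def semiInv (n m k : ℕ) : Submodule ℝ (MatPoly n m) where
  carrier := {p | ∀ a b, polar n a b p = (if a = b then (k : ℝ) else 0) • p}
  add_mem' := fun hp hq a b => by rw [map_add, hp a b, hq a b, smul_add]
  zero_mem' := fun a b => by simp
  smul_mem' := fun t p hp a b => by rw [Derivation.map_smul, hp a b, smul_comm]

theorem mul_mem_semiInv {j k : ℕ} {p q : MatPoly n m} (hp : p ∈ semiInv n m j)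
    (hq : q ∈ semiInv n m k) : p * q ∈ semiInv n m (j + k) := by
  intro a b
  rw [Derivation.leibniz, hp a b, hq a b]
  split_ifs
  · simp only [smul_eq_mul, Algebra.smul_def, Nat.cast_add, map_add]
    ring
  · simp

/-- Polarization replaces column `b` by column `a`, so the determinant vanishes unless `a = b`. -/
theorem minor_mem_semiInv (r : Fin m → Fin n) : minor id r ∈ semiInv n m 1 := by
  intro a b
  rw [minor, derivation_det, Finset.sum_eq_single b]
  · set N : Matrix (Fin m) (Fin m) (MatPoly n m) := of fun i j => X (r i, id j) with hN
    have : (fun i => polar n a b (N i b)) = fun i => N i a := by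
      funext i
      simp [hN, polar_X]
    rw [this]
    split_ifs with h
    · subst h
      simp
    · rw [zero_smul, det_updateCol_eq_zero h]
  · intro d _ hd
    refine det_eq_zero_of_column_eq_zero d fun i => ?_
    simp [polar_X, hd]
  · simp

theorem diffOp_minor_mem {k : ℕ} (r : Fin m → Fin n) {f : MatPoly n m}
    (hf : f ∈ semiInv n m (k + 1)) : diffOp (minor id r) f ∈ semiInv n m k := by
  intro a b
  rw [polar_diffOp, hf a b, minor_mem_semiInv r b a]
  by_cases h : a = b
  · subst h
    simp only [if_true, map_smul, LinearMap.smul_apply, ← sub_smul]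
    push_cast
    ring_nf
  · simp [h, Ne.symm h]

/-! ### Capelli-type identities -/

/-- Expand the minor along its first row. Moving the derivative past the variable turns the sum over
`r₀` into a polarization, plus `n` copies of the term when `j = 0`. The term `j = 0` contributes `k
+ n` and each of the other `s` columns contributes `-1`. -/
theorem sum_pderiv_minor_mul {k : ℕ} {c : Fin (s + 1) → Fin m} (hc : Function.Injective c)
    (r : Fin s → Fin n) {f : MatPoly n m} (hf : f ∈ semiInv n m k) :
    ∑ r₀, pderiv (r₀, c 0) (minor c (Fin.cons r₀ r : Fin (s + 1) → Fin n) * f) =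
      ((k : ℝ) + n - s) • (minor (c ∘ Fin.succ) r * f) := by
  have key : ∀ j, ∑ r₀, pderiv (r₀, c 0) (X (r₀, c j) * (cofactor c r j * f)) =
      (if j = 0 then ((k : ℝ) + n + 1) • (cofactor c r 0 * f) else 0) - cofactor c r 0 * f := by
    intro j
    have h1 : ∀ r₀ : Fin n, pderiv (r₀, c 0) (X (r₀, c j) * (cofactor c r j * f)) =
        X (r₀, c j) * pderiv (r₀, c 0) (cofactor c r j * f) +
          (if j = 0 then cofactor c r 0 * f else 0) := by
      intro r₀
      rw [Derivation.leibniz, pderiv_X, smul_eq_mul, smul_eq_mul]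
      split_ifs with h
      · subst h
        simp
      · rw [Pi.single_eq_of_ne, mul_zero]
        intro h'
        exact h (hc (congrArg Prod.snd h'))
    simp only [h1, Finset.sum_add_distrib]
    rw [← polar_apply, Derivation.leibniz, hf, polar_cofactor hc]
    split_ifs with h' h h
    · subst h
      simp only [Finset.sum_const, Finset.card_univ, Fintype.card_fin, nsmul_eq_mul]
      simp only [smul_eq_mul, Algebra.smul_def, map_add, map_natCast, map_one]
      ring
    · exact absurd (hc h') h
    · subst h; exact absurd rfl h'
    · simp [mul_comm]
  simp only [minor_cons, Finset.sum_mul, map_sum, mul_assoc]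
  rw [Finset.sum_comm]
  simp only [key, Finset.sum_sub_distrib, Finset.sum_ite_eq', Finset.mem_univ, if_true,
    Finset.sum_const, Finset.card_univ, Fintype.card_fin, ← cofactor_zero]
  rw [← Nat.cast_smul_eq_nsmul ℝ]
  push_cast
  module

/-- The same expansion in the opposite order: the term `j = 0` gives `k`, and commuting the
polarization past each of the other `s` cofactors gives `1`. -/
theorem sum_X_mul_diffOp_minor {k : ℕ} {c : Fin (s + 1) → Fin m} (hc : Function.Injective c)
    (r : Fin s → Fin n) {f : MatPoly n m} (hf : f ∈ semiInv n m k) :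
    ∑ r₀, X (r₀, c 0) * diffOp (minor c (Fin.cons r₀ r : Fin (s + 1) → Fin n)) f =
      ((k : ℝ) + s) • diffOp (minor (c ∘ Fin.succ) r) f := by
  have key : ∀ j, ∑ r₀, X (r₀, c 0) * diffOp (X (r₀, c j) * cofactor c r j) f =
      (if j = 0 then ((k : ℝ) - 1) • diffOp (cofactor c r 0) f else 0) +
        diffOp (cofactor c r 0) f := by
    intro j
    simp only [diffOp_mul, diffOp_X]
    rw [← polar_apply, polar_diffOp, hf, polar_cofactor hc]
    split_ifs with h h' h'
    · subst h'
      simp [sub_smul]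
    · exact absurd (hc h).symm h'
    · subst h'; exact absurd rfl h
    · simp
  simp only [minor_cons, map_sum, LinearMap.sum_apply, Finset.mul_sum]
  rw [Finset.sum_comm]
  simp only [key, Finset.sum_add_distrib, Finset.sum_ite_eq', Finset.mem_univ, if_true,
    Finset.sum_const, Finset.card_univ, Fintype.card_fin, ← cofactor_zero]
  rw [← Nat.cast_smul_eq_nsmul ℝ]
  push_cast
  module

theorem sum_fin_succ_fun {M : Type*} [AddCommMonoid M] (F : (Fin (s + 1) → Fin n) → M) :
    ∑ r, F r = ∑ r : Fin s → Fin n, ∑ r₀, F (Fin.cons r₀ r : Fin (s + 1) → Fin n) := by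
  rw [← (Fin.consEquiv fun _ : Fin (s + 1) => Fin n).sum_comp, Fintype.sum_prod_type_right]
  rfl

/-- Contracting one row and one column at a time peels off one factor. The induction passes through
smaller minors, so it needs arbitrary injective column selections. -/
theorem sum_diffOp_minor_mul {k : ℕ} {f : MatPoly n m} (hf : f ∈ semiInv n m k) :
    ∀ {s : ℕ} {c : Fin s → Fin m}, Function.Injective c →
      ∑ r : Fin s → Fin n, diffOp (∏ a, X (r a, c a)) (minor c r * f) =
        (∏ i ∈ Finset.range s, ((k : ℝ) + n - i)) • f := by
  intro s
  induction s with
  | zero => intro c _; simp [minor]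
  | succ s ih =>
    intro c hc
    rw [sum_fin_succ_fun, Finset.prod_range_succ, mul_comm, mul_smul,
      ← ih (hc.comp (Fin.succ_injective s)), Finset.smul_sum]
    refine Finset.sum_congr rfl fun r _ => ?_
    rw [← map_smul, ← sum_pderiv_minor_mul hc r hf, map_sum]
    refine Finset.sum_congr rfl fun r₀ _ => ?_
    rw [Fin.prod_univ_succ, mul_comm, diffOp_mul, Fin.cons_zero, diffOp_X]
    simp

theorem sum_mul_diffOp_minor {k : ℕ} {f : MatPoly n m} (hf : f ∈ semiInv n m k) :
    ∀ {s : ℕ} {c : Fin s → Fin m}, Function.Injective c →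
      ∑ r : Fin s → Fin n, (∏ a, X (r a, c a)) * diffOp (minor c r) f =
        (∏ i ∈ Finset.range s, ((k : ℝ) + i)) • f := by
  intro s
  induction s with
  | zero => intro c _; simp [minor]
  | succ s ih =>
    intro c hc
    rw [sum_fin_succ_fun, Finset.prod_range_succ, mul_comm, mul_smul,
      ← ih (hc.comp (Fin.succ_injective s)), Finset.smul_sum]
    refine Finset.sum_congr rfl fun r _ => ?_
    rw [← mul_smul_comm, ← sum_X_mul_diffOp_minor hc r hf, Finset.mul_sum]
    refine Finset.sum_congr rfl fun r₀ _ => ?_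
    rw [Fin.prod_univ_succ, Fin.cons_zero]
    simp only [Fin.cons_succ, Function.comp_apply]
    ring

theorem minor_perm (σ : Equiv.Perm (Fin m)) (r : Fin m → Fin n) :
    minor id (r ∘ σ) = ((Equiv.Perm.sign σ : ℤ) : MatPoly n m) * minor id r := by
  rw [minor, minor, ← det_permute]
  rfl

theorem minor_eq_sum (r : Fin m → Fin n) :
    minor id r = ∑ σ : Equiv.Perm (Fin m),
      ((Equiv.Perm.sign σ : ℤ) : MatPoly n m) * ∏ a, X ((r ∘ σ) a, id a) := by
  rw [minor, det_apply']
  rfl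

theorem sign_mul_sign (σ : Equiv.Perm (Fin m)) :
    ((Equiv.Perm.sign σ : ℤ) : MatPoly n m) * ((Equiv.Perm.sign σ : ℤ) : MatPoly n m) = 1 := by
  rw [← Int.cast_mul, ← Units.val_mul, Int.units_mul_self]
  simp

/-- A sum over row selections of a product of two minors, one of which may be replaced by its
diagonal term. -/
theorem sum_minor_minor {M : Type*} [AddCommGroup M] [Module (MatPoly n m) M]
    (B : (MatPoly n m) → (MatPoly n m) → M)
    (hB : ∀ (σ : Equiv.Perm (Fin m)) p q,
      B (((Equiv.Perm.sign σ : ℤ) : MatPoly n m) * p) (((Equiv.Perm.sign σ : ℤ) : MatPoly n m) * q)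
        = B p q)
    (hs : ∀ (F : Equiv.Perm (Fin m) → MatPoly n m) q, B (∑ σ, F σ) q = ∑ σ, B (F σ) q) :
    ∑ r : Fin m → Fin n, B (minor id r) (minor id r) =
      m.factorial • ∑ r : Fin m → Fin n, B (∏ a, X (r a, id a)) (minor id r) := by
  have h : ∀ r : Fin m → Fin n, B (minor id r) (minor id r) =
      ∑ σ : Equiv.Perm (Fin m), B (∏ a, X ((r ∘ σ) a, id a)) (minor id (r ∘ σ)) := by
    intro r
    conv_lhs => arg 1; rw [minor_eq_sum]
    rw [hs]
    refine Finset.sum_congr rfl fun σ _ => ?_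
    rw [minor_perm, ← hB σ _ (_ * minor id r), ← mul_assoc, sign_mul_sign, one_mul]
  simp only [h]
  -- Reindexing the row selections by `σ` makes all `m!` inner sums equal.
  rw [Finset.sum_comm, Finset.sum_congr rfl fun σ _ =>
    (Equiv.arrowCongr σ.symm (Equiv.refl (Fin n))).sum_comp
      fun r : Fin m → Fin n => B (∏ a, X (r a, id a)) (minor id r)]
  rw [Finset.sum_const, Finset.card_univ, Fintype.card_perm, Fintype.card_fin]

theorem diffOp_intCast_mul (z : ℤ) (p f : MatPoly n m) :
    diffOp ((z : MatPoly n m) * p) f = (z : MatPoly n m) * diffOp p f := by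
  rw [← zsmul_eq_mul, map_zsmul, LinearMap.smul_apply, zsmul_eq_mul]

theorem sum_minor_mul_diffOp {k : ℕ} {f : MatPoly n m} (hf : f ∈ semiInv n m k) :
    ∑ r : Fin m → Fin n, minor id r * diffOp (minor id r) f =
      (m.factorial * ∏ i ∈ Finset.range m, ((k : ℝ) + i)) • f := by
  rw [sum_minor_minor (fun p q => p * diffOp q f), sum_mul_diffOp_minor hf Function.injective_id,
    mul_smul, Nat.cast_smul_eq_nsmul]
  · intro σ p q
    rw [diffOp_intCast_mul, mul_mul_mul_comm, sign_mul_sign, one_mul]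
  · intro F q
    rw [Finset.sum_mul]

theorem sum_diffOp_minor_minor_mul {k : ℕ} {f : MatPoly n m} (hf : f ∈ semiInv n m k) :
    ∑ r : Fin m → Fin n, diffOp (minor id r) (minor id r * f) =
      (m.factorial * ∏ i ∈ Finset.range m, ((k : ℝ) + n - i)) • f := by
  rw [sum_minor_minor (fun p q => diffOp p (q * f)), sum_diffOp_minor_mul hf Function.injective_id,
    mul_smul, Nat.cast_smul_eq_nsmul]
  · intro σ p q
    rw [diffOp_intCast_mul, mul_assoc, ← zsmul_eq_mul (q * f), map_zsmul, zsmul_eq_mul,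
      ← mul_assoc, sign_mul_sign, one_mul]
  · intro F q
    rw [map_sum, LinearMap.sum_apply]

/-! ### Semi-invariants are spanned by products of minors -/

/-- The diagonal polarization is the Euler operator for the variables of column `a`. -/
theorem coeff_polar_self (a : Fin m) (p : MatPoly n m) (s : Fin n × Fin m →₀ ℕ) :
    coeff s (polar n a a p) = (∑ i, (s (i, a) : ℝ)) * coeff s p := by
  rw [polar_apply]
  induction p using MvPolynomial.induction_on' with
  | monomial t x =>
    simp only [X_mul_pderiv_monomial, coeff_sum, coeff_smul, coeff_monomial, Finset.sum_mul]
    refine Finset.sum_congr rfl fun i _ => ?_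
    split_ifs with h
    · rw [h, nsmul_eq_mul]
    · simp
  | add p q hp hq =>
    simp only [map_add, mul_add, Finset.sum_add_distrib, coeff_add, hp, hq]

theorem semiInv_zero : semiInv n m 0 = Submodule.span ℝ {1} := by
  apply le_antisymm
  · intro p hp
    rw [Submodule.mem_span_singleton]
    refine ⟨coeff 0 p, ?_⟩
    ext s
    rw [coeff_smul, coeff_one, smul_eq_mul]
    split_ifs with h
    · rw [← h, mul_one]
    · rw [mul_zero]
      obtain ⟨⟨i, a⟩, hia⟩ : ∃ x, s x ≠ 0 := by
        by_contra! hc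
        exact h (Finsupp.ext fun x => (hc x).symm)
      have h1 := coeff_polar_self a p s
      rw [hp a a] at h1
      simp only [Nat.cast_zero, ite_self, zero_smul, coeff_zero] at h1
      refine ((mul_eq_zero.1 h1.symm).resolve_left ?_).symm
      refine (Finset.sum_pos' (fun j _ => Nat.cast_nonneg _) ⟨i, Finset.mem_univ _, ?_⟩).ne'
      exact_mod_cast Nat.pos_of_ne_zero hia
  · rw [Submodule.span_singleton_le_iff_mem]
    intro a b
    simp

/-- The span of the `k`-fold products of maximal minors. -/
def minorSpan (n m k : ℕ) : Submodule ℝ (MatPoly n m) :=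
  Submodule.span ℝ (Set.range fun t : Fin k → Fin m → Fin n => ∏ j, minor id (t j))

theorem minor_mul_mem_minorSpan {k : ℕ} (r : Fin m → Fin n) {f : MatPoly n m}
    (hf : f ∈ minorSpan n m k) : minor id r * f ∈ minorSpan n m (k + 1) := by
  have : minorSpan n m k ≤ (minorSpan n m (k + 1)).comap (LinearMap.mulLeft ℝ (minor id r)) := by
    rw [minorSpan, Submodule.span_le]
    rintro _ ⟨t, rfl⟩
    refine Submodule.subset_span ⟨Fin.cons r t, ?_⟩
    simp [Fin.prod_univ_succ]
  exact this hf

/-- Up to a nonzero scalar, `f` is the sum of the products of a minor with `minor(∂) f`, and the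
latter has weight one less. -/
theorem semiInv_eq_minorSpan (k : ℕ) : semiInv n m k = minorSpan n m k := by
  induction k with
  | zero => simp [semiInv_zero, minorSpan, Set.range_const]
  | succ k ih =>
    apply le_antisymm
    · intro f hf
      have h := sum_minor_mul_diffOp hf
      have hc : (m.factorial * ∏ i ∈ Finset.range m, (((k + 1 : ℕ) : ℝ) + i)) ≠ 0 := by
        positivity
      rw [← Submodule.smul_mem_iff _ hc, ← h]
      exact Submodule.sum_mem _ fun r _ =>
        minor_mul_mem_minorSpan r (ih ▸ diffOp_minor_mem r hf)
    · rw [minorSpan, Submodule.span_le]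
      rintro _ ⟨t, rfl⟩
      have h2 : ∏ j : Fin k, minor id (t j.succ) ∈ semiInv n m k :=
        ih ▸ Submodule.subset_span ⟨fun j => t j.succ, rfl⟩
      have := mul_mem_semiInv (minor_mem_semiInv (t 0)) h2
      rw [add_comm] at this
      simpa [Fin.prod_univ_succ] using this

instance finiteDimensional_minorSpan (k : ℕ) : FiniteDimensional ℝ (minorSpan n m k) :=
  FiniteDimensional.span_of_finite ℝ (Set.finite_range _)

instance finiteDimensional_semiInv (k : ℕ) : FiniteDimensional ℝ (semiInv n m k) :=
  semiInv_eq_minorSpan (n := n) (m := m) k ▸ finiteDimensional_minorSpan k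

/-! ### Dimension of the space of semi-invariants -/

theorem finrank_semiInv_succ (k : ℕ) :
    (∏ i ∈ Finset.range m, ((k : ℝ) + 1 + i)) * Module.finrank ℝ (semiInv n m (k + 1)) =
      (∏ i ∈ Finset.range m, ((k : ℝ) + n - i)) * Module.finrank ℝ (semiInv n m k) := by
  let U : (Fin m → Fin n) → semiInv n m k →ₗ[ℝ] semiInv n m (k + 1) := fun r =>
    (LinearMap.mulLeft ℝ (minor id r)).restrict fun f hf => by
      have := mul_mem_semiInv (minor_mem_semiInv r) hf
      rwa [add_comm] at this
  let V : (Fin m → Fin n) → semiInv n m (k + 1) →ₗ[ℝ] semiInv n m k := fun r =>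
    (diffOp (minor id r)).restrict fun f hf => diffOp_minor_mem r hf
  have h1 : ∑ r, U r ∘ₗ V r =
      (m.factorial * ∏ i ∈ Finset.range m, ((k : ℝ) + 1 + i)) • LinearMap.id := by
    ext1 f
    apply Subtype.ext
    have := sum_minor_mul_diffOp f.2
    push_cast at this
    rw [LinearMap.sum_apply, Submodule.coe_sum]
    exact this
  have h2 : ∑ r, V r ∘ₗ U r =
      (m.factorial * ∏ i ∈ Finset.range m, ((k : ℝ) + n - i)) • LinearMap.id := by
    ext1 f
    apply Subtype.ext
    have := sum_diffOp_minor_minor_mul f.2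
    rw [LinearMap.sum_apply, Submodule.coe_sum]
    exact this
  -- The sums of `U V` and `V U` are scalars on spaces of consecutive weights, so equal traces
  -- relate the two dimensions.
  have h3 : LinearMap.trace ℝ _ (∑ r, U r ∘ₗ V r) = LinearMap.trace ℝ _ (∑ r, V r ∘ₗ U r) := by
    rw [map_sum, map_sum]
    exact Finset.sum_congr rfl fun r _ => LinearMap.trace_comp_comm' _ _
  rw [h1, h2, map_smul, map_smul, LinearMap.trace_id, LinearMap.trace_id, smul_eq_mul, smul_eq_mul,
    mul_assoc, mul_assoc] at h3
  exact mul_left_cancel₀ (by positivity) h3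

/-- Reversing both index ranges in the denominator makes its factors independent of `m` and `k`, so
that `k` enters only through the range of `j`, as the recursion in `k` requires. -/
theorem hookProduct_eq (n m k : ℕ) : hookProduct n m k =
    (∏ j ∈ Finset.range k, ∏ i ∈ Finset.range m, ((j : ℝ) + n - i)) /
      ∏ j ∈ Finset.range k, ∏ i ∈ Finset.range m, ((j : ℝ) + 1 + i) := by
  have icc : ∀ (N : ℕ) (f : ℕ → ℝ), ∏ i ∈ Finset.Icc 1 N, f i = ∏ i ∈ Finset.range N, f (i + 1) := by
    intro N f
    induction N with
    | zero => simp
    | succ N ih => rw [Finset.prod_Icc_succ_top (by omega), ih, Finset.prod_range_succ]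
  simp only [hookProduct, Finset.prod_div_distrib]
  congr 1
  · rw [Finset.prod_comm, icc]
    refine Finset.prod_congr rfl fun j _ => ?_
    rw [icc]
    refine Finset.prod_congr rfl fun i _ => ?_
    push_cast
    ring
  · rw [Finset.prod_comm, icc, ← Finset.prod_range_reflect]
    refine Finset.prod_congr rfl fun j hj => ?_
    rw [icc, ← Finset.prod_range_reflect]
    refine Finset.prod_congr rfl fun i hi => ?_
    rw [Finset.mem_range] at hi hj
    obtain ⟨d, rfl⟩ := Nat.exists_eq_add_of_lt hi
    obtain ⟨e, rfl⟩ := Nat.exists_eq_add_of_lt hj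
    rw [show i + d + 1 - 1 - i = d by omega, show j + e + 1 - 1 - j = e by omega]
    push_cast
    ring

theorem finrank_semiInv (k : ℕ) :
    (Module.finrank ℝ (semiInv n m k) : ℝ) = hookProduct n m k := by
  rw [hookProduct_eq]
  induction k with
  | zero =>
    rw [semiInv_zero, finrank_span_singleton (one_ne_zero (α := MatPoly n m))]
    simp
  | succ k ih =>
    have h := finrank_semiInv_succ (n := n) (m := m) k
    have hpos : (∏ i ∈ Finset.range m, ((k : ℝ) + 1 + i)) ≠ 0 := by positivity
    rw [Finset.prod_range_succ, Finset.prod_range_succ, mul_div_mul_comm, ← ih,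
      ← mul_div_assoc, eq_div_iff hpos]
    linarith

/-! ### Duality between the Schur module and products of minors -/

/-- A polynomial in the entries of a matrix as a function of the columns. -/
def evalColumns (n m : ℕ) : MatPoly n m →ₗ[ℝ] ((Fin m → Space n) → ℝ) :=
  LinearMap.pi fun u => (aeval fun x : Fin n × Fin m => u x.2 x.1).toLinearMap

theorem evalColumns_apply (p : MatPoly n m) (u : Fin m → Space n) :
    evalColumns n m p u = aeval (fun x : Fin n × Fin m => u x.2 x.1) p := rfl

theorem evalColumns_injective : Function.Injective (evalColumns n m) := by
  intro p q h
  refine MvPolynomial.funext fun x => ?_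
  have := congrFun h fun a => WithLp.toLp 2 fun i => x (i, a)
  simpa [evalColumns_apply, coe_aeval_eq_eval] using this

theorem evalColumns_minor (r : Fin m → Fin n) (u : Fin m → Space n) :
    evalColumns n m (minor id r) u = det (of fun a c => u c (r a)) := by
  rw [evalColumns_apply, minor, AlgHom.map_det]
  congr 1
  ext a c
  simp

theorem evalColumns_prod_minor (t : Fin k → Fin m → Fin n) (u : Fin m → Space n) :
    evalColumns n m (∏ j, minor id (t j)) u = ∏ j, det (of fun a c => u c (t j a)) := by
  rw [evalColumns_apply, map_prod]
  exact Finset.prod_congr rfl fun j _ => evalColumns_minor (t j) u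

theorem permute_tprod (σ : Equiv.Perm (Fin m × Fin k)) (v : Fin m × Fin k → Space n) :
    permute σ (PiTensorProduct.tprod ℝ v) = PiTensorProduct.tprod ℝ (v ∘ σ.symm) :=
  PiTensorProduct.reindex_tprod σ v

/-- The tensor with the vector `u i` in all boxes of row `i`. -/
def rowTensor (k : ℕ) (u : Fin m → Space n) : BoxTensor n m k :=
  PiTensorProduct.tprod ℝ fun b => u b.1

/-- Writing row permutations as surjective self-maps prepares for inclusion–exclusion over the boxes
missed by an arbitrary row-preserving map. -/
theorem rowSymmetrizer_tprod (v : Fin m × Fin k → Space n) :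
    rowSymmetrizer n m k (PiTensorProduct.tprod ℝ v) =
      ∑ τ : Fin m × Fin k → Fin m × Fin k with (∀ b, (τ b).1 = b.1) ∧ Function.Surjective τ,
        PiTensorProduct.tprod ℝ (v ∘ τ) := by
  rw [rowSymmetrizer, LinearMap.sum_apply]
  refine Finset.sum_bij (fun σ _ => σ.symm) ?_ ?_ ?_ ?_
  · intro σ hσ
    simp only [Finset.mem_filter, Finset.mem_univ, true_and] at hσ ⊢
    refine ⟨fun b => ?_, σ.symm.surjective⟩
    rw [← hσ (σ.symm b), Equiv.apply_symm_apply]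
  · intro σ _ ρ _ h
    exact Equiv.symm_bijective.injective (DFunLike.coe_injective h)
  · intro τ hτ
    simp only [Finset.mem_filter, Finset.mem_univ, true_and] at hτ
    have hb : Function.Bijective τ := Finite.surjective_iff_bijective.1 hτ.2
    refine ⟨(Equiv.ofBijective τ hb).symm, ?_, rfl⟩
    simp only [Finset.mem_filter, Finset.mem_univ, true_and]
    intro b
    exact (hτ.1 _).symm.trans (congrArg Prod.fst (Equiv.ofBijective_apply_symm_apply τ hb b))
  · intro σ _
    exact permute_tprod σ v

/-- Polarization in every row: the row symmetrization of a pure tensor is a combination of tensors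
that are constant along the rows. -/
theorem rowSymmetrizer_tprod_eq_sum (v : Fin m × Fin k → Space n) :
    rowSymmetrizer n m k (PiTensorProduct.tprod ℝ v) =
      ∑ T : Finset (Fin m × Fin k), (((-1) ^ T.card : ℤ) : ℝ) •
        rowTensor k fun i => ∑ b with b ∉ T ∧ b.1 = i, v b := by
  have h1 : ∀ T : Finset (Fin m × Fin k),
      (rowTensor k fun i => ∑ b with b ∉ T ∧ b.1 = i, v b) =
        ∑ τ : Fin m × Fin k → Fin m × Fin k with ∀ b, (τ b).1 = b.1,
          if T ⊆ (Finset.univ.image τ)ᶜ then PiTensorProduct.tprod ℝ (v ∘ τ) else 0 := by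
    intro T
    rw [rowTensor, MultilinearMap.map_sum_finset, ← Finset.sum_filter, Finset.filter_filter]
    refine Finset.sum_congr ?_ fun τ _ => rfl
    ext τ
    simp only [Fintype.mem_piFinset, Finset.mem_filter, Finset.mem_univ, true_and,
      Finset.subset_compl_comm (s := T)]
    constructor
    · intro h
      refine ⟨fun b => (h b).2, fun x hx => ?_⟩
      obtain ⟨b, _, rfl⟩ := Finset.mem_image.1 hx
      exact Finset.mem_compl.2 (h b).1
    · intro h b
      exact ⟨Finset.mem_compl.1 (h.2 (Finset.mem_image_of_mem τ (Finset.mem_univ b))), h.1 b⟩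
  simp only [h1, Finset.smul_sum]
  rw [Finset.sum_comm, rowSymmetrizer_tprod, ← Finset.filter_filter, Finset.sum_filter]
  refine Finset.sum_congr rfl fun τ _ => ?_
  simp only [smul_ite, smul_zero]
  rw [← Finset.sum_filter, ← Finset.sum_smul, ← Int.cast_sum,
    -- The alternating sum over subsets of the missed boxes vanishes unless no box is missed.
    show (Finset.univ.filter fun T => T ⊆ (Finset.univ.image τ)ᶜ) =
      (Finset.univ.image τ)ᶜ.powerset by ext; simp, Finset.sum_powerset_neg_one_pow_card]
  have : (Finset.univ.image τ)ᶜ = ∅ ↔ Function.Surjective τ := by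
    simp [Finset.eq_univ_iff_forall, Function.Surjective]
  simp only [this]
  split_ifs <;> simp

theorem rowSymmetrizer_rowTensor (u : Fin m → Space n) :
    rowSymmetrizer n m k (rowTensor k u) =
      (Finset.card {σ : Equiv.Perm (Fin m × Fin k) | ∀ b, (σ b).1 = b.1} : ℝ) • rowTensor k u := by
  rw [rowSymmetrizer, LinearMap.sum_apply, Nat.cast_smul_eq_nsmul, ← Finset.sum_const]
  refine Finset.sum_congr rfl fun σ hσ => ?_
  rw [rowTensor, permute_tprod]
  congr 1
  funext b
  have := (Finset.mem_filter.1 hσ).2 (σ.symm b)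
  rw [Equiv.apply_symm_apply] at this
  simp [this]

theorem range_rowSymmetrizer :
    LinearMap.range (rowSymmetrizer n m k) = Submodule.span ℝ (Set.range (rowTensor k)) := by
  apply le_antisymm
  · rw [LinearMap.range_eq_map, ← PiTensorProduct.span_tprod_eq_top, Submodule.map_span,
      Submodule.span_le]
    rintro _ ⟨_, ⟨v, rfl⟩, rfl⟩
    rw [SetLike.mem_coe, rowSymmetrizer_tprod_eq_sum]
    exact Submodule.sum_mem _ fun T _ =>
      Submodule.smul_mem _ _ (Submodule.subset_span (Set.mem_range_self _))
  · rw [Submodule.span_le]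
    rintro _ ⟨u, rfl⟩
    have hc : (Finset.card {σ : Equiv.Perm (Fin m × Fin k) | ∀ b, (σ b).1 = b.1} : ℝ) ≠ 0 := by
      rw [Nat.cast_ne_zero, Finset.card_ne_zero]
      exact ⟨1, by simp⟩
    rw [SetLike.mem_coe, ← Submodule.smul_mem_iff _ hc, ← rowSymmetrizer_rowTensor]
    exact LinearMap.mem_range_self _ _

theorem schurModule_eq_span : schurModule n m k =
    Submodule.span ℝ (Set.range fun u => columnAntisymmetrizer n m k (rowTensor k u)) := by
  rw [schurModule, LinearMap.range_comp, range_rowSymmetrizer, Submodule.map_span,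
    ← Set.range_comp]
  rfl

/-- The basis of the tensor power given by the standard basis. -/
def boxBasis (n m k : ℕ) : Module.Basis (Fin m × Fin k → Fin n) ℝ (BoxTensor n m k) :=
  Basis.piTensorProduct fun _ => (EuclideanSpace.basisFun (Fin n) ℝ).toBasis

/-- The product of the column minors is the determinant of a block diagonal matrix. In its Leibniz
expansion only the permutations that preserve every column survive. -/
theorem boxBasis_coord_columnAntisymmetrizer (t : Fin m × Fin k → Fin n) (u : Fin m → Space n) :
    (boxBasis n m k).coord t (columnAntisymmetrizer n m k (rowTensor k u)) =
      evalColumns n m (∏ j, minor id fun a => t (a, j)) u := by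
  rw [evalColumns_prod_minor fun j a => t (a, j), ← det_blockDiagonal, det_apply',
    columnAntisymmetrizer, LinearMap.sum_apply, map_sum, Finset.sum_filter]
  refine Finset.sum_congr rfl fun σ _ => ?_
  split_ifs with h
  · rw [LinearMap.smul_apply, map_smul, smul_eq_mul, rowTensor, permute_tprod,
      Module.Basis.coord_apply, boxBasis, Basis.piTensorProduct_repr_tprod_apply,
      ← Equiv.prod_comp σ]
    congr 1
    refine Finset.prod_congr rfl fun b _ => ?_
    rw [blockDiagonal_apply, if_pos (h b)]
    simp
  · push Not at h
    obtain ⟨b, hb⟩ := h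
    rw [Finset.prod_eq_zero (Finset.mem_univ b), mul_zero]
    rw [blockDiagonal_apply, if_neg hb]

/-- The pairing of a functional on the tensor power with the generators of the Schur module. -/
def schurPairing (n m k : ℕ) :
    Module.Dual ℝ (BoxTensor n m k) →ₗ[ℝ] ((Fin m → Space n) → ℝ) :=
  LinearMap.pi fun u => Module.Dual.eval ℝ _ (columnAntisymmetrizer n m k (rowTensor k u))

theorem ker_schurPairing :
    LinearMap.ker (schurPairing n m k) = (schurModule n m k).dualAnnihilator := by
  ext φ
  rw [schurModule_eq_span, LinearMap.mem_ker, Submodule.mem_dualAnnihilator]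
  constructor
  · intro h w hw
    have : Submodule.span ℝ
        (Set.range fun u => columnAntisymmetrizer n m k (rowTensor k u)) ≤ LinearMap.ker φ := by
      rw [Submodule.span_le]
      rintro _ ⟨u, rfl⟩
      exact congrFun h u
    exact this hw
  · intro h
    funext u
    exact h _ (Submodule.subset_span ⟨u, rfl⟩)

theorem range_schurPairing :
    LinearMap.range (schurPairing n m k) = (minorSpan n m k).map (evalColumns n m) := by
  rw [LinearMap.range_eq_map, ← (boxBasis n m k).dualBasis.span_eq, Submodule.map_span, minorSpan,
    Submodule.map_span, ← Set.range_comp, ← Set.range_comp,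
    -- Currying and swapping the arguments match the tensor basis indices with `k`-tuples of row
    -- selections.
    ← (Equiv.curry (Fin m) (Fin k) (Fin n)).symm.surjective.range_comp]
  rw [← (Equiv.piComm fun (_ : Fin m) (_ : Fin k) => Fin n).surjective.range_comp
    ((evalColumns n m) ∘ fun t : Fin k → Fin m → Fin n => ∏ j, minor id (t j))]
  congr 2
  funext t u
  simp only [Function.comp_apply, Module.Basis.coe_dualBasis]
  exact boxBasis_coord_columnAntisymmetrizer _ u

/-- The pairing has the annihilator of the Schur module as its kernel and the span of products of
minors as its range, so rank–nullity equates the dimensions. -/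
theorem finrank_schurModule :
    (Module.finrank ℝ (schurModule n m k) : ℝ) = hookProduct n m k := by
  have : FiniteDimensional ℝ (BoxTensor n m k) := (boxBasis n m k).finiteDimensional_of_finite
  rw [← finrank_semiInv, semiInv_eq_minorSpan, Nat.cast_inj,
    (Submodule.equivMapOfInjective _ evalColumns_injective (minorSpan n m k)).finrank_eq, ← range_schurPairing]
  have h1 := LinearMap.finrank_range_add_finrank_ker (schurPairing n m k)
  have h2 := Subspace.finrank_add_finrank_dualAnnihilator_eq (schurModule n m k)
  rw [ker_schurPairing, Subspace.dual_finrank_eq] at h1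
  omega

/-! ### Sup norm and `L²` norm in translation-invariant spaces -/

section TranslationInvariant

variable {G : Type*} [Group G] [TopologicalSpace G] [IsTopologicalGroup G] [CompactSpace G]
  [MeasurableSpace G] [BorelSpace G]

/-- In a translation invariant space of functions of dimension `d` on a compact group, the square of
the supremum norm is at most `d` times the square of the `L²` norm. -/
theorem sq_apply_le_finrank_mul_integral (μ : Measure G) [μ.IsHaarMeasure] [IsProbabilityMeasure μ]
    (F : Submodule ℝ C(G, ℝ)) [FiniteDimensional ℝ F]
    (hF : ∀ f ∈ F, ∀ h : G, ∃ f' ∈ F, ∀ x, f' x = f (h * x)) {f : C(G, ℝ)} (hf : f ∈ F) (g : G) :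
    f g ^ 2 ≤ Module.finrank ℝ F * ∫ x, f x ^ 2 ∂μ := by
  let T : C(G, ℝ) →ₗ[ℝ] Lp ℝ 2 μ := (ContinuousMap.toLp 2 μ ℝ).toLinearMap
  have hT : Function.Injective T := ContinuousMap.toLp_injective μ
  have hinner : ∀ f h : C(G, ℝ), inner ℝ (T f) (T h) = ∫ x, f x * h x ∂μ := by
    intro f h
    refine (ContinuousMap.inner_toLp μ f h).trans (integral_congr_ae (.of_forall fun x => ?_))
    simp [mul_comm]
  let b := stdOrthonormalBasis ℝ (F.map T)
  have hb : ∀ i, ∃ e ∈ F, T e = b i := fun i => (b i).2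
  choose e heF heT using hb
  have horth : ∀ i j, ∫ x, e i x * e j x ∂μ = if i = j then 1 else 0 := by
    intro i j
    rw [← hinner, heT, heT, ← Submodule.coe_inner, orthonormal_iff_ite.1 b.orthonormal]
  have hint : ∀ f : C(G, ℝ), Integrable f μ := fun f =>
    f.continuous.integrable_of_hasCompactSupport (HasCompactSupport.of_compactSpace f)
  have hsq : ∀ c : Fin (Module.finrank ℝ (F.map T)) → ℝ,
      ∫ x, (∑ i, c i • e i : C(G, ℝ)) x ^ 2 ∂μ = ∑ i, c i ^ 2 := by
    intro c
    simp only [pow_two]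
    rw [← hinner]
    simp only [map_sum, map_smul, sum_inner, inner_sum, inner_smul_left, inner_smul_right, hinner,
      horth]
    simp
  have hexp : ∀ f ∈ F, ∃ c : Fin (Module.finrank ℝ (F.map T)) → ℝ, f = ∑ i, c i • e i := by
    intro f hf
    let y : F.map T := ⟨T f, Submodule.mem_map_of_mem hf⟩
    refine ⟨fun i => b.repr y i, hT ?_⟩
    have := congrArg Subtype.val (b.sum_repr y)
    refine this.symm.trans ?_
    rw [map_sum, Submodule.coe_sum]
    exact Finset.sum_congr rfl fun i _ => by rw [map_smul, heT]; rfl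
  -- The diagonal of the reproducing kernel of `F`; the bound below is Cauchy–Schwarz in the
  -- orthonormal basis.
  set K : G → ℝ := fun x => ∑ i, e i x ^ 2 with hK
  have hbound : ∀ f ∈ F, ∀ x, f x ^ 2 ≤ (∫ y, f y ^ 2 ∂μ) * K x := by
    intro f hf x
    obtain ⟨c, rfl⟩ := hexp f hf
    rw [hsq]
    simpa using Finset.sum_mul_sq_le_sq_mul_sq Finset.univ c fun i => e i x
  have hK0 : ∀ x, 0 ≤ K x := fun x => Finset.sum_nonneg fun i _ => sq_nonneg _
  have hKle : ∀ x y, K x ≤ K y := by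
    intro x y
    -- The kernel section at `x` has value and squared norm both equal to `K x`. Translation by `x *
    -- y⁻¹` moves that value to `y` and keeps the norm, so `K x ^ 2 ≤ K x * K y`.
    have hmem : (∑ i, e i x • e i : C(G, ℝ)) ∈ F :=
      Submodule.sum_mem _ fun i _ => F.smul_mem _ (heF i)
    obtain ⟨f', hf', hff'⟩ := hF _ hmem (x * y⁻¹)
    have h1 := hbound f' hf' y
    simp only [hff'] at h1
    rw [integral_mul_left_eq_self (fun z => (∑ i, e i x • e i : C(G, ℝ)) z ^ 2) (x * y⁻¹), hsq,
      inv_mul_cancel_right] at h1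
    have h2 : (∑ i, e i x • e i : C(G, ℝ)) x = K x := by simp [hK, pow_two]
    rw [h2, pow_two] at h1
    rcases (hK0 x).eq_or_lt with h0 | h0
    · rw [← h0]
      exact hK0 y
    · exact le_of_mul_le_mul_left h1 h0
  -- Each basis function has norm one, and no dimension is lost in passing to `L²`.
  have hKint : ∫ x, K x ∂μ = Module.finrank ℝ F := by
    simp only [hK]
    rw [integral_finsetSum _ fun i _ => ?_]
    · simp only [pow_two, horth, if_true]
      simp [(Submodule.equivMapOfInjective T hT F).finrank_eq]
    · exact hint (e i ^ 2)
  have hKg : K g = Module.finrank ℝ F := by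
    rw [← hKint, show K = fun _ => K g from funext fun x => (hKle x g).antisymm (hKle g x)]
    simp
  rw [mul_comm, ← hKg]
  exact hbound f hf g

end TranslationInvariant

/-! ### Semi-invariants as functions on the orthogonal group and the Grassmannian -/

/-- The substitution of `A X` for `X` in polynomials in the entries of `X`. -/
def substMul (A : Matrix (Fin n) (Fin n) ℝ) : MatPoly n m →ₐ[ℝ] MatPoly n m :=
  aeval fun x => ∑ j, A x.1 j • X (j, x.2)

theorem polar_substMul (A : Matrix (Fin n) (Fin n) ℝ) (a b : Fin m) (p : MatPoly n m) :
    polar n a b (substMul A p) = substMul A (polar n a b p) := by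
  induction p using MvPolynomial.induction_on with
  | C t => simp [substMul]
  | add p q hp hq => simp only [map_add, hp, hq]
  | mul_X p x hp =>
    have hx : polar n a b (substMul A (X x)) = substMul A (polar n a b (X x)) := by
      obtain ⟨i, c⟩ := x
      simp only [substMul, aeval_X, map_sum, Derivation.map_smul, polar_X]
      split_ifs <;> simp
    simp only [map_mul, Derivation.leibniz, map_add, smul_eq_mul, hp, hx]

theorem substMul_mem {k : ℕ} (A : Matrix (Fin n) (Fin n) ℝ) {p : MatPoly n m}
    (hp : p ∈ semiInv n m k) : substMul A p ∈ semiInv n m k := by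
  intro a b
  rw [polar_substMul, hp a b, map_smul]

/-- The entries of an orthogonal matrix as continuous functions on `O(n)`. -/
def entryO (i j : Fin n) : C(O n, ℝ) :=
  ⟨fun g => g.1 i j, continuous_subtype_val.matrix_elem i j⟩

/-- A polynomial in the entries of an `n × m` matrix as a function on `O(n)`, through the first `m`
columns. -/
def evalO (h : m ≤ n) : MatPoly n m →ₗ[ℝ] C(O n, ℝ) :=
  (aeval fun x : Fin n × Fin m =>
    (entryO x.1 (Fin.castLE h x.2))).toLinearMap

theorem evalO_apply (h : m ≤ n) (p : MatPoly n m) (g : O n) :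
    evalO h p g = aeval (fun x : Fin n × Fin m => g.1 x.1 (Fin.castLE h x.2)) p := by
  have : ((ContinuousMap.evalAlgHom ℝ ℝ g).comp (aeval fun x : Fin n × Fin m =>
      (entryO x.1 (Fin.castLE h x.2)))) =
      aeval (fun x : Fin n × Fin m => g.1 x.1 (Fin.castLE h x.2)) := by
    ext x
    simp [entryO]
  exact congrArg (fun φ => φ p) this

theorem evalO_mul_left (h : m ≤ n) (p : MatPoly n m) (g x : O n) :
    evalO h p (g * x) = evalO h (substMul g.1 p) x := by
  rw [evalO_apply, evalO_apply, substMul, ← AlgHom.comp_apply, comp_aeval]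
  congr 2
  funext y
  simp [Matrix.mul_apply]

theorem evalO_sq_le (h : m ≤ n) {k : ℕ} {p : MatPoly n m} (hp : p ∈ semiInv n m k)
    (g : O n) : evalO h p g ^ 2 ≤ hookProduct n m k * ∫ x, evalO h p x ^ 2 ∂haarO n := by
  have : (haarO n).IsHaarMeasure := by unfold haarO; infer_instance
  refine (sq_apply_le_finrank_mul_integral (haarO n) ((semiInv n m k).map (evalO h)) ?_
    ⟨p, hp, rfl⟩ g).trans ?_
  · rintro _ ⟨q, hq, rfl⟩ x
    exact ⟨_, ⟨_, substMul_mem x.1 hq, rfl⟩, fun y => (evalO_mul_left h q x y).symm⟩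
  · rw [← finrank_semiInv]
    refine mul_le_mul_of_nonneg_right ?_ (integral_nonneg fun x => sq_nonneg _)
    -- Restriction to `O(n)` need not be shown injective: an upper bound on the dimension suffices.
    exact_mod_cast Submodule.finrank_map_le _ _

/-- The polynomial representing a functional on `⋀ᵐ ℝⁿ` on simple `m`-vectors. -/
def functionalPoly (l : Ext n m →ₗ[ℝ] ℝ) : MatPoly n m :=
  (m.factorial : ℝ)⁻¹ • ∑ r : Fin m → Fin n,
    l (wedge fun a => EuclideanSpace.basisFun (Fin n) ℝ (r a)) • minor id r

theorem functionalPoly_mem (l : Ext n m →ₗ[ℝ] ℝ) : functionalPoly l ∈ semiInv n m 1 :=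
  Submodule.smul_mem _ _ <| Submodule.sum_mem _ fun r _ =>
    Submodule.smul_mem _ _ (minor_mem_semiInv r)

theorem functionalPoly_pow_mem (l : Ext n m →ₗ[ℝ] ℝ) (k : ℕ) :
    functionalPoly l ^ k ∈ semiInv n m k := by
  induction k with
  | zero => rw [pow_zero, semiInv_zero]; exact Submodule.mem_span_singleton_self 1
  | succ k ih => rw [pow_succ]; exact mul_mem_semiInv ih (functionalPoly_mem l)

theorem wedge_perm (σ : Equiv.Perm (Fin m)) (u : Fin m → Space n) (l : Ext n m →ₗ[ℝ] ℝ) :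
    l (wedge (u ∘ σ)) = ((Equiv.Perm.sign σ : ℤ) : ℝ) * l (wedge u) := by
  rw [wedge, AlternatingMap.map_perm, Units.smul_def, map_zsmul, zsmul_eq_mul]

theorem functional_wedge_eq_sum (l : Ext n m →ₗ[ℝ] ℝ) (u : Fin m → Space n) :
    l (wedge u) = ∑ r : Fin m → Fin n,
      (∏ a, u a (r a)) * l (wedge fun a => EuclideanSpace.basisFun (Fin n) ℝ (r a)) := by
  have hu : u = fun a => ∑ j, u a j • EuclideanSpace.basisFun (Fin n) ℝ j :=
    funext fun a => ((EuclideanSpace.basisFun (Fin n) ℝ).sum_repr (u a)).symm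
  let f := (l.compAlternatingMap (exteriorPower.ιMulti ℝ m (M := Space n))).toMultilinearMap
  change f u = ∑ r : Fin m → Fin n, (∏ a, u a (r a)) * f _
  conv_lhs => rw [hu]
  rw [MultilinearMap.map_sum]
  simp only [MultilinearMap.map_smul_univ, smul_eq_mul]

/-- The sum runs over all row selections, not only increasing ones. Expanding the minors produces
the multilinear expansion of `l (wedge u)` once for each permutation, and the factor `1 / m!`
compensates. -/
theorem evalColumns_functionalPoly (l : Ext n m →ₗ[ℝ] ℝ) (u : Fin m → Space n) :
    evalColumns n m (functionalPoly l) u = l (wedge u) := by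
  have h : ∀ r : Fin m → Fin n, l (wedge fun a => EuclideanSpace.basisFun (Fin n) ℝ (r a)) *
      det (of fun a c => u c (r a)) = ∑ σ : Equiv.Perm (Fin m), (∏ a, u a ((r ∘ σ) a)) *
        l (wedge fun a => EuclideanSpace.basisFun (Fin n) ℝ ((r ∘ σ) a)) := by
    intro r
    rw [det_apply', Finset.mul_sum]
    refine Finset.sum_congr rfl fun σ _ => ?_
    have := wedge_perm σ (fun a => EuclideanSpace.basisFun (Fin n) ℝ (r a)) l
    rw [show (fun a => EuclideanSpace.basisFun (Fin n) ℝ ((r ∘ σ) a)) =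
      (fun a => EuclideanSpace.basisFun (Fin n) ℝ (r a)) ∘ σ from rfl, this]
    simp only [of_apply, Function.comp_apply]
    ring
  rw [functionalPoly, map_smul, map_sum, Pi.smul_apply, Finset.sum_apply]
  simp only [map_smul, Pi.smul_apply, evalColumns_minor, smul_eq_mul, h]
  have h2 : ∀ σ : Equiv.Perm (Fin m), ∑ r : Fin m → Fin n, (∏ a, u a ((r ∘ σ) a)) *
      l (wedge fun a => EuclideanSpace.basisFun (Fin n) ℝ ((r ∘ σ) a)) = l (wedge u) := fun σ =>
    ((Equiv.arrowCongr σ.symm (Equiv.refl (Fin n))).sum_comp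
      fun r : Fin m → Fin n => (∏ a, u a (r a)) *
        l (wedge fun a => EuclideanSpace.basisFun (Fin n) ℝ (r a))).trans
      (functional_wedge_eq_sum l u).symm
  rw [Finset.sum_comm, Finset.sum_congr rfl fun σ _ => h2 σ]
  rw [Finset.sum_const, Finset.card_univ, Fintype.card_perm,
    Fintype.card_fin, nsmul_eq_mul, inv_mul_cancel_left₀ (by positivity)]

theorem toEuclideanLin_single (A : Matrix (Fin n) (Fin n) ℝ) (i j : Fin n) :
    Matrix.toEuclideanLin A (EuclideanSpace.single j (1 : ℝ)) i = A i j := by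
  simp [Matrix.toLpLin_apply]

theorem functional_orbitMap (h : m ≤ n) (l : Ext n m →ₗ[ℝ] ℝ) (g : O n) :
    l (orbitMap h g).1 = evalO h (functionalPoly l) g := by
  have : (orbitMap h g).1 = wedge fun a : Fin m =>
      Matrix.toEuclideanLin g.1 (EuclideanSpace.single (Fin.castLE h a) (1 : ℝ)) := by
    simp only [orbitMap, extAct, baseVector, wedge, exteriorPower.map_apply_ιMulti]
    rfl
  rw [this, ← evalColumns_functionalPoly, evalColumns_apply, evalO_apply]
  simp only [toEuclideanLin_single]

/-- An orthonormal `m`-frame extends to an orthonormal basis, whose vectors are the columns of an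
orthogonal matrix. -/
theorem orbitMap_surjective (h : m ≤ n) : Function.Surjective (orbitMap h) := by
  rintro ⟨_, u, hu, rfl⟩
  let s : Set (Fin n) := Set.range (Fin.castLE h)
  let v : Fin n → Space n := fun i => if hi : (i : ℕ) < m then u ⟨i, hi⟩ else 0
  have hvu : ∀ a, v (Fin.castLE h a) = u a := fun a => by simp [v]
  have hv : Orthonormal ℝ (s.domRestrict v) := by
    have hs : s.domRestrict v = u ∘ (Equiv.ofInjective _ (Fin.castLE_injective h)).symm := by
      funext x
      obtain ⟨a, rfl⟩ := (Equiv.ofInjective _ (Fin.castLE_injective h)).surjective x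
      simp [Set.domRestrict, hvu]
    rw [hs]
    exact hu.comp _ (Equiv.injective _)
  obtain ⟨b, hb⟩ := hv.exists_orthonormalBasis_extension_of_card_eq (by simp)
  let A : Matrix (Fin n) (Fin n) ℝ := of fun i j => b j i
  have hA : A ∈ Matrix.orthogonalGroup (Fin n) ℝ := by
    rw [Matrix.mem_orthogonalGroup_iff']
    ext i j
    rw [Matrix.mul_apply, Matrix.one_apply, ← orthonormal_iff_ite.1 b.orthonormal i j,
      PiLp.inner_apply]
    simp [A, mul_comm]
  refine ⟨⟨A, hA⟩, Subtype.ext ?_⟩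
  simp only [orbitMap, extAct, baseVector, wedge, exteriorPower.map_apply_ιMulti]
  congr 1
  funext a
  rw [← hvu, ← hb _ ⟨a, rfl⟩]
  ext i
  exact toEuclideanLin_single A i _

theorem integral_haarGrassmannian (h : m ≤ n) (l : Ext n m →ₗ[ℝ] ℝ) (j : ℕ) :
    ∫ x : grassmannian n m, l x.1 ^ j ∂haarGrassmannian h =
      ∫ g, evalO h (functionalPoly l) g ^ j ∂haarO n := by
  rw [haarGrassmannian, integral_map (measurable_orbitMap h).aemeasurable]
  · simp only [functional_orbitMap]
  · exact ((measurable_iff_dual.1 measurable_subtype_coe l).pow_const j).aestronglyMeasurable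

end Comass

end

/-! ### The two inequalities and the dimension -/

theorem theorem3p3 (n m k : ℕ) (hmn : m ≤ n) (hk : 1 ≤ k)
    (l : Comass.Ext n m →ₗ[ℝ] ℝ) :
    (∃ M : ℝ, IsGreatest ((fun x => |l x|) '' Comass.grassmannian n m) M ∧
      Comass.evenNorm hmn k l ≤ M ∧
      M ≤ Comass.hookProduct n m k ^ (1 / (2 * (k : ℝ))) * Comass.evenNorm hmn k l) ∧
    (Module.finrank ℝ (Comass.schurModule n m k) : ℝ) = Comass.hookProduct n m k := by
  refine ⟨?_, Comass.finrank_schurModule⟩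
  set f : C(Comass.O n, ℝ) := Comass.evalO hmn (Comass.functionalPoly l) with hf
  -- The maximum is found on the compact group `O(n)` and carried to the Grassmannian by the
  -- surjective orbit map.
  obtain ⟨g, -, hg⟩ := isCompact_univ.exists_isMaxOn Set.univ_nonempty f.continuous.abs.continuousOn
  have hmax : ∀ x, |f x| ≤ |f g| := fun x => hg (Set.mem_univ x)
  have h2k : 2 * k ≠ 0 := by omega
  have hexp : 1 / (2 * (k : ℝ)) = ((2 * k : ℕ) : ℝ)⁻¹ := by push_cast; rw [one_div]
  have heven : ∀ x : ℝ, 0 ≤ x ^ (2 * k) := fun x => (even_two_mul k).pow_nonneg x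
  have hcont : ∀ h : C(Comass.O n, ℝ), MeasureTheory.Integrable h (Comass.haarO n) := by
    have : (Comass.haarO n).IsHaarMeasure := by unfold Comass.haarO; infer_instance
    exact fun h => h.continuous.integrable_of_hasCompactSupport (HasCompactSupport.of_compactSpace h)
  set J : ℝ := ∫ x, f x ^ (2 * k) ∂Comass.haarO n with hJ
  have hJ0 : 0 ≤ J := MeasureTheory.integral_nonneg fun x => heven _
  have hnorm : Comass.evenNorm hmn k l = J ^ (((2 * k : ℕ) : ℝ)⁻¹) := by
    rw [Comass.evenNorm, Comass.integral_haarGrassmannian, hexp]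
  have hroot : |f g| = (|f g| ^ (2 * k)) ^ (((2 * k : ℕ) : ℝ)⁻¹) :=
    (Real.pow_rpow_inv_natCast (abs_nonneg _) h2k).symm
  refine ⟨|f g|, ⟨⟨_, (Comass.orbitMap hmn g).2, ?_⟩, ?_⟩, ?_, ?_⟩
  · simp only [Comass.functional_orbitMap, hf]
  · rintro _ ⟨x, hx, rfl⟩
    obtain ⟨y, hy⟩ := Comass.orbitMap_surjective hmn ⟨x, hx⟩
    have hxy : x = (Comass.orbitMap hmn y).1 := congrArg Subtype.val hy.symm
    simp only [hxy, Comass.functional_orbitMap]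
    exact hmax y
  · rw [hnorm, hroot]
    refine Real.rpow_le_rpow hJ0 ?_ (by positivity)
    calc J ≤ ∫ _, |f g| ^ (2 * k) ∂Comass.haarO n := by
          refine MeasureTheory.integral_mono (hcont (f ^ (2 * k)))
            (MeasureTheory.integrable_const _) fun x => ?_
          rw [← (even_two_mul k).pow_abs]
          exact pow_le_pow_left₀ (abs_nonneg _) (hmax x) _
      _ = |f g| ^ (2 * k) := by simp
  · have hd : 0 ≤ Comass.hookProduct n m k := by
      rw [← Comass.finrank_schurModule]
      positivity
    rw [hnorm, hexp, ← Real.mul_rpow hd hJ0]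
    conv_lhs => rw [hroot]
    refine Real.rpow_le_rpow (by positivity) ?_ (by positivity)
    -- The `L²` estimate is applied to `ℓ ^ k`, whose square is `ℓ ^ (2 * k)`.
    have h := Comass.evalO_sq_le hmn (Comass.functionalPoly_pow_mem l k) g
    have hpow : ∀ x, Comass.evalO hmn (Comass.functionalPoly l ^ k) x ^ 2 = f x ^ (2 * k) := by
      intro x
      rw [hf, Comass.evalO_apply, Comass.evalO_apply, map_pow, ← pow_mul, mul_comm]
    simp only [hpow] at h
    rwa [(even_two_mul k).pow_abs]
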